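/- Let $\mathsf{GLP}$ be the propositional normal modal logic with one modality $[\alpha]$ for each ordinal $\alpha$ (and $\langle\alpha\rangle=\neg[\alpha]\neg$), axiomatized by all propositional tautologies and the schemata $[\alpha](\chi\to\psi)\to([\alpha]\chi\to[\alpha]\psi)$, $[\alpha]([\alpha]\chi\to\chi)\to[\alpha]\chi$, $\langle\alpha\rangle\psi\to[\beta]\langle\alpha\rangle\psi$ for $\alpha<\beta$, and $[\alpha]\psi\to[\beta]\psi$ for $\alpha\le\beta$, with modus ponens and necessitation for each modality. A worm is a formula $\langle\alpha_1\rangle\cdots\langle\alpha_n\rangle\top$ with $n\ge 0$, identified with the string $\alpha_1\cdots\alpha_n$ of ordinals; $\lambda$ is the empty string, $S$ is the class of worms, $S_\alpha$ is the class of worms all of whose modalities are at least $\alpha$, and $\eta\in A$ means that $\eta$ occurs in $A$. For worms $A,B$ put $A<_\alpha B$ iff $\mathsf{GLP}\vdash B\to\langle\alpha\rangle A$, and $A\le_\alpha B$ iff $A<_\alpha B$ or $\mathsf{GLP}\vdash A\leftrightarrow B$. A worm $A$ is in Beklemishev normal form ($\mathsf{BNF}$) iff $A=\lambda$, or $A$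 is of the form $A_k\,\alpha\,A_{k-1}\,\alpha\cdots\alpha\,A_1$ with $\alpha=\min(A)$, $k\ge1$, where each $A_i\in S_{\alpha+1}$ is in $\mathsf{BNF}$ and $A_{i+1}\le_{\alpha+1}A_i$ for $1\le i<k$. For an ordinal $\xi$ and a worm $A$: - $h_\xi(A)$, the $\xi$-head of $A$, is the longest initial segment of $A$ (from the left) that lies in $S_\xi$; - for $A\in S_\xi$, $\xi\downarrow A$ is the worm obtained by replacing each $\beta$ in $A$ by $-\xi+\beta$, the unique $\delta$ with $\xi+\delta=\beta$; - $\Omega_\xi(A)=\sup\{\Omega_\xi(B)+1 : B\in S,\ B<_\xi A\}$; - for $A\in S_\xi$, $o_\xi(A)=\sup\{o_\xi(B)+1 : B\in S_\xi,\ B<_\xi A\}$. For an ordinal $\gamma$ with Cantor normal form $\gamma=\omega^{\gamma_1}+\cdots+\omega^{\gamma_N}$, $\gamma_1\ge\cdots\ge\gamma_N$, let $\mathsf{CNP}(\alpha,\gamma)$ be the largest of the partial sums $\sum_{i=1}^{k}\omega^{\gamma_i}$ ($0\le k\le N$) that is at most $\alpha$, and write $\alpha\sim_\gamma\beta$ iff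 $\mathsf{CNP}(\alpha,\gamma)=\mathsf{CNP}(\beta,\gamma)$. **Theorem.** Each relation $<_\alpha$ is well-founded on $S$ (so that $\Omega_\xi$ and $o_\xi$ are well defined), and for every worm $A$ in $\mathsf{BNF}$ and all ordinals $\xi,\zeta$ the following five conditions are equivalent: 1. $\Omega_\xi(A)=\Omega_\zeta(A)$; 2. $o_\xi(h_\xi(A))=o_\zeta(h_\zeta(A))$; 3. $\xi\downarrow h_\xi(A)=\zeta\downarrow h_\zeta(A)$; 4. $h_\xi(A)=h_\zeta(A)$ and $\xi\downarrow h_\xi(A)=\zeta\downarrow h_\zeta(A)$; 5. $h_\xi(A)=h_\zeta(A)$ and $\xi\sim_\eta\zeta$ for every $\eta\in h_\xi(A)$. -/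

import Mathlib

universe u

namespace GLP

/-! ## The logic -/

/-- Propositional modal formulas with one modality `[α]` for each ordinal `α`;
`var` are the propositional variables, and `⊥`, `→` the Boolean primitives. -/
inductive Formula : Type (u + 1) where
  | var (n : ℕ) : Formula
  | bot : Formula
  | imp (φ ψ : Formula) : Formula
  | box (α : Ordinal.{u}) (φ : Formula) : Formula

namespace Formula

def neg (φ : Formula.{u}) : Formula.{u} := imp φ bot

def top : Formula.{u} := neg bot

def and (φ ψ : Formula.{u}) : Formula.{u} := neg (imp φ (neg ψ))

def iff (φ ψ : Formula.{u}) : Formula.{u} := and (imp φ ψ) (imp ψ φ)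

/-- `⟨α⟩φ`. -/
def dia (α : Ordinal.{u}) (φ : Formula.{u}) : Formula.{u} := neg (box α (neg φ))

/-- Boolean truth of a formula when variables and boxed formulas are read as atoms,
with truth values given by `v`. -/
def Truth (v : Formula.{u} → Prop) : Formula.{u} → Prop
  | var n => v (var n)
  | bot => False
  | imp φ ψ => Truth v φ → Truth v ψ
  | box α φ => v (box α φ)

/-- Instances of classical propositional tautologies. -/
def IsTautology (φ : Formula.{u}) : Prop := ∀ v : Formula.{u} → Prop, Truth v φ

end Formula

open Formula in
/-- Theorems of `GLP`. -/
inductive Provable : Formula.{u} → Prop where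
  | taut {φ : Formula.{u}} (h : φ.IsTautology) : Provable φ
  | distr (α : Ordinal.{u}) (χ ψ : Formula.{u}) :
      Provable (imp (box α (imp χ ψ)) (imp (box α χ) (box α ψ)))
  | loeb (α : Ordinal.{u}) (χ : Formula.{u}) :
      Provable (imp (box α (imp (box α χ) χ)) (box α χ))
  | negIntro {α β : Ordinal.{u}} (h : α < β) (ψ : Formula.{u}) :
      Provable (imp (dia α ψ) (box β (dia α ψ)))
  | mono {α β : Ordinal.{u}} (h : α ≤ β) (ψ : Formula.{u}) :
      Provable (imp (box α ψ) (box β ψ))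
  | mp {φ ψ : Formula.{u}} (h₁ : Provable (imp φ ψ)) (h₂ : Provable φ) : Provable ψ
  | nec (α : Ordinal.{u}) {φ : Formula.{u}} (h : Provable φ) : Provable (box α φ)

/-! ## Worms -/

/-- A worm `⟨α₁⟩…⟨αₙ⟩⊤`, identified with the string `α₁…αₙ` of its modalities. -/
abbrev Worm : Type (u + 1) := List Ordinal.{u}

/-- The formula `⟨α₁⟩…⟨αₙ⟩⊤` denoted by the string `α₁…αₙ`. -/
def Worm.toFormula : Worm.{u} → Formula.{u}
  | [] => Formula.top
  | α :: A => Formula.dia α (Worm.toFormula A)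

/-- `A ∈ S_α`: every modality of `A` is at least `α`. -/
def MemS (α : Ordinal.{u}) (A : Worm.{u}) : Prop := ∀ β ∈ A, α ≤ β

/-- `A <_α B`, on all worms. -/
def WLt (α : Ordinal.{u}) (A B : Worm.{u}) : Prop :=
  Provable (Formula.imp B.toFormula (Formula.dia α A.toFormula))

/-- Provable equivalence of worms. -/
def WEquiv (A B : Worm.{u}) : Prop := Provable (Formula.iff A.toFormula B.toFormula)

/-- `A ≤_α B`: the order is taken modulo provable equivalence. -/
def WLe (α : Ordinal.{u}) (A B : Worm.{u}) : Prop := WLt α A B ∨ WEquiv A B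

/-- The restriction of `<_α` to `S_α × S_α`. -/
def SLt (α : Ordinal.{u}) (A B : Worm.{u}) : Prop := MemS α A ∧ MemS α B ∧ WLt α A B

/-- Beklemishev normal forms. The list `L` is `A_k, …, A_1`, and
`[α].intercalate L` is the string `A_k α … α A_1`. -/
inductive BNF : Worm.{u} → Prop where
  | nil : BNF []
  | join (A : Worm.{u}) (α : Ordinal.{u}) (L : List Worm.{u})
      (hmin : IsLeast {β | β ∈ A} α)
      (hL : L ≠ [])
      (hA : A = [α].intercalate L)
      (hS : ∀ B ∈ L, MemS (α + 1) B)
      (hB : ∀ B ∈ L, BNF B)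
      (hle : L.IsChain (fun B C => WLe (α + 1) B C)) : BNF A

/-- The `ξ`-head of a worm. -/
noncomputable def head (ξ : Ordinal.{u}) : Worm.{u} → Worm.{u}
  | [] => []
  | ζ :: A => if ξ ≤ ζ then ζ :: head ξ A else []

/-- `ξ ↓ A`: each `β` in `A` is replaced by `-ξ + β` (the unique `δ` with `ξ + δ = β`,
which Mathlib writes `β - ξ`); used for `A ∈ S_ξ` only. -/
noncomputable def demote (ξ : Ordinal.{u}) (A : Worm.{u}) : Worm.{u} := A.map (fun β => β - ξ)

/-! ## Order types -/

open Classical in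
/-- The rank `rk r a = sup {rk r b + 1 : r b a}` of a point in the well-founded part of `r`;
the value `0` elsewhere is never used for a well-founded `r`. -/
noncomputable def rk {X : Type u} (r : X → X → Prop) (a : X) : Ordinal.{u} :=
  if h : Acc r a then h.rank else 0

theorem rk_eq {X : Type u} {r : X → X → Prop} (hr : WellFounded r) (a : X) :
    rk r a = ⨆ b : {b // r b a}, (rk r b.1 + 1) := by
  have h : ∀ b, rk r b = (hr.apply b).rank := fun b => dif_pos (hr.apply b)
  simp only [h]
  exact (hr.apply a).rank_eq

/-- `Ω_ξ(A)`, the rank of `A` in `<_ξ` on all worms. -/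
noncomputable def Omega (ξ : Ordinal.{u}) (A : Worm.{u}) : Ordinal.{u + 1} := rk (WLt ξ) A

/-- `o_ξ(A)` for `A ∈ S_ξ`, the rank of `A` in `<_ξ` on `S_ξ`. -/
noncomputable def o (ξ : Ordinal.{u}) (A : Worm.{u}) : Ordinal.{u + 1} := rk (SLt ξ) A

/-! ## Cantor normal form projections -/

/-- The ordinal `ω^{ξ₁} + … + ω^{ξₙ}` for a list of exponents `ξ₁, …, ξₙ`. -/
noncomputable def cnfSum (L : List Ordinal.{u}) : Ordinal.{u} :=
  (L.map (fun x => Ordinal.omega0 ^ x)).sum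

/-- `L = ξ₁ ≥ … ≥ ξₙ` are the exponents of the Cantor normal form of `α`. -/
def IsCNF (α : Ordinal.{u}) (L : List Ordinal.{u}) : Prop :=
  L.Pairwise (fun x y => x ≥ y) ∧ α = cnfSum L

/-- Cantor normal form approximations: the partial sums of the Cantor normal form. -/
def CNA (α : Ordinal.{u}) : Set Ordinal.{u} :=
  {s | ∃ L : List Ordinal.{u}, IsCNF α L ∧ ∃ k ≤ L.length, s = cnfSum (L.take k)}

/-- The Cantor normal form projection of `ζ` on `ξ`, the largest element of `CNA ξ`
that is at most `ζ` (see `isGreatest_CNP`). -/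
noncomputable def CNP (ζ ξ : Ordinal.{u}) : Ordinal.{u} := sSup {x | x ∈ CNA ξ ∧ x ≤ ζ}

/-- `α ∼_γ β`. -/
def Sim (γ α β : Ordinal.{u}) : Prop := CNP α γ = CNP β γ

theorem cnfSum_cons (a : Ordinal.{u}) (L : List Ordinal.{u}) :
    cnfSum (a :: L) = Ordinal.omega0 ^ a + cnfSum L := by
  simp [cnfSum]

theorem cnfSum_lt {L : List Ordinal.{u}} {b : Ordinal.{u}} (h : ∀ x ∈ L, x < b) :
    cnfSum L < Ordinal.omega0 ^ b := by
  induction L with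
  | nil => simpa [cnfSum] using Ordinal.opow_pos b Ordinal.omega0_pos
  | cons a L ih =>
    rw [cnfSum_cons]
    refine Ordinal.isPrincipal_add_omega0_opow b ?_ (ih fun x hx => h x (List.mem_cons_of_mem _ hx))
    exact (Ordinal.opow_lt_opow_iff_right Ordinal.one_lt_omega0).2 (h a List.mem_cons_self)

theorem log_cnfSum {a : Ordinal.{u}} {L : List Ordinal.{u}}
    (h : (a :: L).Pairwise (fun x y => x ≥ y)) :
    Ordinal.log Ordinal.omega0 (cnfSum (a :: L)) = a := by
  have hlt : cnfSum (a :: L) < Ordinal.omega0 ^ (a + 1) := by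
    refine cnfSum_lt fun x hx => ?_
    rcases List.mem_cons.1 hx with rfl | hx
    · exact Order.lt_add_one_iff.2 le_rfl
    · exact Order.lt_add_one_iff.2 ((List.pairwise_cons.1 h).1 x hx)
  have hle : Ordinal.omega0 ^ a ≤ cnfSum (a :: L) := by
    rw [cnfSum_cons]; exact le_self_add
  have hne : cnfSum (a :: L) ≠ 0 :=
    (lt_of_lt_of_le (Ordinal.opow_pos a Ordinal.omega0_pos) hle).ne'
  apply le_antisymm
  · exact Order.lt_add_one_iff.1 ((Ordinal.lt_opow_iff_log_lt Ordinal.one_lt_omega0 hne).1 hlt)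
  · exact (Ordinal.opow_le_iff_le_log Ordinal.one_lt_omega0 hne).1 hle

theorem IsCNF.unique {α : Ordinal.{u}} {L M : List Ordinal.{u}}
    (hL : IsCNF α L) (hM : IsCNF α M) : L = M := by
  have pos : ∀ (a : Ordinal.{u}) (K : List Ordinal.{u}), cnfSum (a :: K) ≠ 0 := by
    intro a K
    rw [cnfSum_cons]
    exact (lt_of_lt_of_le (Ordinal.opow_pos a Ordinal.omega0_pos) le_self_add).ne'
  induction L generalizing α M with
  | nil =>
    cases M with
    | nil => rfl
    | cons b M => exact absurd (hM.2.symm.trans hL.2) (pos b M)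
  | cons a L ih =>
    cases M with
    | nil => exact absurd (hL.2.symm.trans hM.2) (pos a L)
    | cons b M =>
      have hs : cnfSum (a :: L) = cnfSum (b :: M) := hL.2.symm.trans hM.2
      have hab : a = b := by rw [← log_cnfSum hL.1, ← log_cnfSum hM.1, hs]
      subst hab
      rw [cnfSum_cons, cnfSum_cons] at hs
      have := ih ⟨(List.pairwise_cons.1 hL.1).2, rfl⟩
        ⟨(List.pairwise_cons.1 hM.1).2, add_left_cancel hs⟩
      rw [this]

theorem exists_isCNF (α : Ordinal.{u}) : ∃ L, IsCNF α L := by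
  induction α using WellFoundedLT.induction with
  | ind α ih =>
    rcases eq_or_ne α 0 with rfl | h0
    · exact ⟨[], List.Pairwise.nil, by simp [cnfSum]⟩
    · have hle := Ordinal.opow_log_le_self Ordinal.omega0 h0
      have hadd := Ordinal.add_sub_cancel_of_le hle
      have hlt : α - Ordinal.omega0 ^ Ordinal.log Ordinal.omega0 α < α := by
        refine lt_of_le_of_ne (Ordinal.sub_le_self _ _) fun he => ?_
        have h1 := Ordinal.lt_opow_succ_log_self Ordinal.one_lt_omega0 α
        rw [he] at hadd
        have h2 : ∀ n : ℕ, Ordinal.omega0 ^ Ordinal.log Ordinal.omega0 α * n ≤ α := by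
          intro n
          induction n with
          | zero => simp
          | succ n ihn =>
            have : ((n + 1 : ℕ) : Ordinal.{u}) = 1 + n := by
              rw [Nat.add_comm, Nat.cast_add, Nat.cast_one]
            rw [this, mul_add, mul_one]
            conv_rhs => rw [← hadd]
            exact add_le_add_right ihn _
        rw [Ordinal.opow_succ] at h1
        refine absurd h1 (not_lt.2 ?_)
        refine (Ordinal.mul_le_iff_of_isSuccLimit Ordinal.isSuccLimit_omega0).2 fun b hb => ?_
        obtain ⟨n, rfl⟩ := Ordinal.lt_omega0.1 hb
        exact h2 n
      obtain ⟨L, hL, hs⟩ := ih _ hlt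
      refine ⟨Ordinal.log Ordinal.omega0 α :: L, ?_, ?_⟩
      · refine List.pairwise_cons.2 ⟨fun x hx => ?_, hL⟩
        cases L with
        | nil => simp at hx
        | cons b M =>
          have hb : b ≤ Ordinal.log Ordinal.omega0 α := by
            rw [← log_cnfSum hL, ← hs]
            exact Ordinal.log_mono_right _ hlt.le
          rcases List.mem_cons.1 hx with rfl | hx
          · exact hb
          · exact ((List.pairwise_cons.1 hL).1 x hx).trans hb
      · rw [cnfSum_cons, ← hs, hadd]

theorem isGreatest_CNP (ζ ξ : Ordinal.{u}) :
    IsGreatest {x | x ∈ CNA ξ ∧ x ≤ ζ} (CNP ζ ξ) := by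
  obtain ⟨L, hL⟩ := exists_isCNF ξ
  have hfin : (CNA ξ).Finite := by
    refine ((Set.finite_Iic L.length).image (fun k => cnfSum (L.take k))).subset ?_
    rintro s ⟨M, hM, k, hk, rfl⟩
    obtain rfl := hM.unique hL
    exact ⟨k, hk, rfl⟩
  have hne : {x | x ∈ CNA ξ ∧ x ≤ ζ}.Nonempty :=
    ⟨0, ⟨L, hL, 0, Nat.zero_le _, by simp [cnfSum]⟩, bot_le⟩
  have hf : {x | x ∈ CNA ξ ∧ x ≤ ζ}.Finite := hfin.subset fun x hx => hx.1
  exact ⟨hne.csSup_mem hf, fun x hx => le_csSup hf.bddAbove hx⟩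

end GLP

namespace GLP

/-! ## Derived rules of the logic -/

/-! The rank of `A` in `<_ξ` depends only on its `ξ`-head (`Omega_eq_o_head`), and `ξ + ·`
identifies `S_0` with `S_ξ` (`o_eq_o_demote`), so `Ω_ξ(A) = o_0(ξ ↓ h_ξ(A))`. Since `<_0` is linear
modulo equivalence (`wlt_trichotomy`), equal ranks mean equivalent worms; heads and demotions
preserve normal forms, and equivalent normal forms coincide (`NF.eq_of_entails`). This settles
conditions 1–3. Both heads are prefixes of `A`, so demotions of equal length come from the same
head, and entrywise equality `η - ξ = η - ζ` is exactly `ξ ∼_η ζ` (`sim_iff`).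

The order theory needs irreflexivity and well-foundedness. By Löb, `A <_α A` would refute `A`, so
irreflexivity amounts to the consistency of worms. This comes from a polytopological model on the
ordinals: a proof uses finitely many instances of the two-modality axioms, whose modalities are
mapped increasingly into `ℕ`, and truth sets are tame enough for derived sets to be open in the next
topology. Well-foundedness follows because worms are well-quasi-ordered under `WeakLe`, by a minimal
bad sequence argument on the splitting `h ++ μ :: r` at the first minimal modality. -/

/-- `φ` provably implies `ψ`. -/
def Entails (φ ψ : Formula.{u}) : Prop := Provable (Formula.imp φ ψ)

infix:50 " ⊩ " => Entails

section Calculus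

open Formula

variable {φ ψ χ : Formula.{u}} {α β : Ordinal.{u}}

theorem Entails.mp (h : φ ⊩ ψ) (h' : Provable φ) : Provable ψ := Provable.mp h h'

theorem Entails.refl (φ : Formula.{u}) : φ ⊩ φ := .taut fun _ h => h

theorem Entails.trans (h : φ ⊩ ψ) (h' : ψ ⊩ χ) : φ ⊩ χ := by
  refine .mp (.mp (.taut (φ := imp (imp φ ψ) (imp (imp ψ χ) (imp φ χ))) ?_) h) h'
  intro v; simp only [Truth]; tauto

theorem entails_top (φ : Formula.{u}) : φ ⊩ top := .taut fun _ _ h => h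

theorem Entails.and (h : φ ⊩ ψ) (h' : φ ⊩ χ) : φ ⊩ and ψ χ := by
  refine .mp (.mp (.taut (φ := imp (imp φ ψ) (imp (imp φ χ) (imp φ (Formula.and ψ χ)))) ?_) h) h'
  intro v; simp only [Truth, Formula.and, neg]; tauto

theorem and_left (φ ψ : Formula.{u}) : and φ ψ ⊩ φ :=
  .taut fun v => by simp only [Truth, Formula.and, neg]; tauto

theorem and_right (φ ψ : Formula.{u}) : and φ ψ ⊩ ψ :=
  .taut fun v => by simp only [Truth, Formula.and, neg]; tauto

theorem provable_iff : Provable (iff φ ψ) ↔ φ ⊩ ψ ∧ ψ ⊩ φ := by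
  refine ⟨fun h => ⟨.mp (and_left _ _) h, .mp (and_right _ _) h⟩, fun h => ?_⟩
  refine .mp (.mp (.taut (φ := imp (imp φ ψ) (imp (imp ψ φ) (Formula.iff φ ψ))) ?_) h.1) h.2
  intro v; simp only [Truth, Formula.iff, Formula.and, neg]; tauto

theorem Entails.contra (h : φ ⊩ ψ) : neg ψ ⊩ neg φ := by
  refine .mp (.taut (φ := imp (imp φ ψ) (imp (neg ψ) (neg φ))) ?_) h
  intro v; simp only [Truth, neg]; tauto

theorem entails_neg_neg (φ : Formula.{u}) : φ ⊩ neg (neg φ) :=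
  .taut fun v => by simp only [Truth, neg]; tauto

theorem Entails.curry (h : Formula.and φ ψ ⊩ χ) : φ ⊩ imp ψ χ := by
  refine .mp (.taut (φ := imp (imp (Formula.and φ ψ) χ) (imp φ (imp ψ χ))) ?_) h
  intro v; simp only [Truth, Formula.and, neg]; tauto

theorem Entails.uncurry (h : φ ⊩ imp ψ χ) : Formula.and φ ψ ⊩ χ := by
  refine .mp (.taut (φ := imp (imp φ (imp ψ χ)) (imp (Formula.and φ ψ) χ)) ?_) h
  intro v; simp only [Truth, Formula.and, neg]; tauto

theorem Entails.box (α : Ordinal.{u}) (h : φ ⊩ ψ) : box α φ ⊩ box α ψ :=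
  .mp (.distr α φ ψ) (.nec α h)

theorem Entails.dia (α : Ordinal.{u}) (h : φ ⊩ ψ) : dia α φ ⊩ dia α ψ :=
  (h.contra.box α).contra

theorem dia_anti (h : α ≤ β) (φ : Formula.{u}) : dia β φ ⊩ dia α φ :=
  Entails.contra (.mono h (neg φ))

/-- Transitivity is extracted from Löb's axiom applied to `φ ∧ [α]φ`. -/
theorem box_box (α : Ordinal.{u}) (φ : Formula.{u}) : box α φ ⊩ box α (box α φ) := by
  let χ := Formula.and φ (Formula.box α φ)
  have h : φ ⊩ imp (Formula.box α χ) χ :=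
    Entails.curry ((and_left _ _).and ((and_right _ _).trans ((and_left _ _).box α)))
  exact ((h.box α).trans (.loeb α χ)).trans ((and_right _ _).box α)

theorem dia_dia (α : Ordinal.{u}) (φ : Formula.{u}) : dia α (dia α φ) ⊩ dia α φ :=
  ((box_box α (neg φ)).trans ((entails_neg_neg _).box α)).contra

/-- As `⟨β⟩ψ` implies `[α]⟨β⟩ψ`, it holds at whatever `α`-successor witnesses `φ`. -/
theorem dia_and (h : β < α) (φ ψ : Formula.{u}) :
    and (dia α φ) (dia β ψ) ⊩ dia α (and φ (dia β ψ)) := by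
  set χ := dia β ψ
  have h1 : χ ⊩ imp (neg (and φ χ)) (neg φ) :=
    .taut fun v => by simp only [Truth, Formula.and, neg]; tauto
  have h2 : Formula.and χ (Formula.box α (neg (and φ χ))) ⊩ Formula.box α (neg φ) :=
    Entails.uncurry ((show χ ⊩ Formula.box α χ from .negIntro h ψ).trans
      ((h1.box α).trans (.distr α _ _)))
  refine .mp (.taut (φ := imp (imp (and χ (Formula.box α (neg (and φ χ)))) (Formula.box α (neg φ)))
    (imp (and (Formula.dia α φ) χ) (Formula.dia α (and φ χ)))) ?_) h2
  intro v
  simp only [Truth, Formula.and, neg, Formula.dia]; tauto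

theorem provable_neg_of_entails_dia (h : φ ⊩ dia α φ) : Provable (neg φ) := by
  have h1 : Formula.box α (neg φ) ⊩ neg φ := (entails_neg_neg _).trans h.contra
  exact h1.mp (.mp (.loeb α (neg φ)) (.nec α h1))

end Calculus

/-! ## Iterated derivatives on the ordinals -/

open Filter Set Topology

/-- The Cantor–Bendixson rank of an ordinal as a point of the ordinals. -/
noncomputable def cbRank (a : Ordinal.{0}) : Ordinal.{0} :=
  sInf {e | a = 0 ∨ ∃ b < a, ∀ x, ∀ _ : x < a, b < x → cbRank x < e}
termination_by a

theorem cbRank_eq (a : Ordinal.{0}) :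
    cbRank a = sInf {e | a = 0 ∨ ∃ b < a, ∀ x, ∀ _ : x < a, b < x → cbRank x < e} := by
  rw [cbRank]

theorem cbRank_le (a : Ordinal.{0}) : cbRank a ≤ a := by
  induction a using WellFoundedLT.induction with
  | ind a ih =>
    rw [cbRank_eq]
    refine csInf_le' ?_
    rcases eq_zero_or_pos a with h | h
    · exact Or.inl h
    · exact Or.inr ⟨0, h, fun x hx _ => (ih x hx).trans_lt hx⟩

theorem exists_cbRank_lt {a : Ordinal.{0}} (ha : 0 < a) :
    ∃ b < a, ∀ x < a, b < x → cbRank x < cbRank a := by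
  have h := csInf_mem (s := {e | a = 0 ∨ ∃ b < a, ∀ x, ∀ _ : x < a, b < x → cbRank x < e})
    ⟨a, Or.inr ⟨0, ha, fun x hx _ => (cbRank_le x).trans_lt hx⟩⟩
  rw [← cbRank_eq] at h
  exact h.resolve_left ha.ne'

theorem exists_cbRank_ge {a b y : Ordinal.{0}} (hy : y < cbRank a) (hb : b < a) :
    ∃ x, b < x ∧ x < a ∧ y ≤ cbRank x := by
  by_contra! h
  refine absurd hy (not_lt.2 ?_)
  rw [cbRank_eq]
  exact csInf_le' (Or.inr ⟨b, hb, fun x hx hbx => h x hbx hx⟩)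

/-- A point near `a` of rank at least `y` exists; if its rank overshoots, descend to a smaller
point, still above `b`. -/
theorem exists_cbRank_eq {a b y : Ordinal.{0}} (hy : y < cbRank a) (hb : b < a) :
    ∃ x, b < x ∧ x < a ∧ cbRank x = y := by
  induction a using WellFoundedLT.induction with
  | ind a ih =>
    obtain ⟨x, hbx, hxa, hx⟩ := exists_cbRank_ge hy hb
    rcases hx.eq_or_lt with h | h
    · exact ⟨x, hbx, hxa, h.symm⟩
    · obtain ⟨z, h1, h2, h3⟩ := ih x hxa h hbx
      exact ⟨z, h1, h2.trans hxa, h3⟩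

/-- Were the rank of `a = c + ω^e` some `r < e`, points close below `a` would have rank below `r`.
But `max b c + ω^r` is such a point, and by induction has rank at least `r`. -/
theorem le_cbRank_add_opow (e c : Ordinal.{0}) : e ≤ cbRank (c + Ordinal.omega0 ^ e) := by
  induction e using WellFoundedLT.induction generalizing c with
  | ind e ih =>
    have hpos : ∀ e : Ordinal.{0}, 0 < Ordinal.omega0 ^ e := fun e =>
      Ordinal.opow_pos e Ordinal.omega0_pos
    by_contra! hlt
    set a := c + Ordinal.omega0 ^ e with ha
    have hca : c < a := lt_add_of_pos_right c (hpos e)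
    obtain ⟨b, hb, h⟩ := exists_cbRank_lt (bot_le.trans_lt hca)
    have hm : max b c < a := max_lt hb hca
    obtain ⟨d, hd⟩ := exists_add_of_le (le_max_right b c)
    rw [hd, ha] at hm
    have hde : d + Ordinal.omega0 ^ (cbRank a) < Ordinal.omega0 ^ e :=
      Ordinal.isPrincipal_add_omega0_opow e (lt_of_add_lt_add_left hm)
        ((Ordinal.opow_lt_opow_iff_right Ordinal.one_lt_omega0).2 hlt)
    refine absurd (ih _ hlt (max b c)) (not_le.2 (h _ ?_ ?_))
    · rw [hd, add_assoc, ha]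
      exact add_lt_add_right hde c
    · exact (le_max_left b c).trans_lt (lt_add_of_pos_right _ (hpos _))

theorem cbRank_surjective : Function.Surjective cbRank := by
  intro y
  have h := le_cbRank_add_opow (y + 1) 0
  obtain ⟨x, -, -, hx⟩ := exists_cbRank_eq ((Order.lt_add_one_iff.2 le_rfl).trans_le h)
    (b := 0) (by rw [zero_add]; exact Ordinal.opow_pos _ Ordinal.omega0_pos)
  exact ⟨x, hx⟩

theorem eventually_nhdsLE_iff {a : Ordinal.{0}} (ha : 0 < a) {p : Ordinal.{0} → Prop} :
    (∀ᶠ x in 𝓝[≤] a, p x) ↔ ∃ b < a, ∀ x ≤ a, b < x → p x := by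
  rw [Filter.Eventually, mem_nhdsLE_iff_exists_Ioc_subset' ha]
  exact ⟨fun ⟨b, hb, h⟩ => ⟨b, hb, fun x hx hbx => h ⟨hbx, hx⟩⟩,
    fun ⟨b, hb, h⟩ => ⟨b, hb, fun x hx => h x hx.2 hx.1⟩⟩

theorem eventually_eventually_nhdsLE {a : Ordinal.{0}} {p : Ordinal.{0} → Prop}
    (h : ∀ᶠ x in 𝓝[≤] a, p x) : ∀ᶠ x in 𝓝[≤] a, ∀ᶠ y in 𝓝[≤] x, p y := by
  rcases eq_zero_or_pos a with rfl | ha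
  · filter_upwards [self_mem_nhdsWithin] with x hx
    obtain rfl : x = 0 := le_antisymm hx bot_le
    exact h
  · obtain ⟨b, hb, h⟩ := (eventually_nhdsLE_iff ha).1 h
    refine (eventually_nhdsLE_iff ha).2 ⟨b, hb, fun x hx hbx => ?_⟩
    exact (eventually_nhdsLE_iff (bot_le.trans_lt hbx)).2
      ⟨b, hbx, fun y hy hby => h y (hy.trans hx) hby⟩

/-- Neighbourhoods in an increasing sequence of topologies on the ordinals (Icard topologies):
first the initial segments, then at each step the left order topology together with
the preimages under `cbRank` of the previous one. -/
noncomputable def nbhd : ℕ → Ordinal.{0} → Filter Ordinal.{0}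
  | 0, a => 𝓟 (Iic a)
  | n + 1, a => 𝓝[≤] a ⊓ comap cbRank (nbhd n (cbRank a))

theorem nbhd_succ_le (n : ℕ) (a : Ordinal.{0}) : nbhd (n + 1) a ≤ nbhd n a := by
  induction n generalizing a with
  | zero => exact inf_le_left.trans (le_principal_iff.2 self_mem_nhdsWithin)
  | succ n ih => exact inf_le_inf_left _ (comap_mono (ih _))

theorem nbhd_antitone (a : Ordinal.{0}) : Antitone fun n => nbhd n a :=
  antitone_nat_of_succ_le fun n => nbhd_succ_le n a

theorem eventually_eventually_nbhd {n : ℕ} {a : Ordinal.{0}} {p : Ordinal.{0} → Prop}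
    (h : ∀ᶠ x in nbhd n a, p x) : ∀ᶠ x in nbhd n a, ∀ᶠ y in nbhd n x, p y := by
  induction n generalizing a p with
  | zero =>
    simp only [nbhd, eventually_principal, mem_Iic] at h ⊢
    exact fun x hx y hy => h y (hy.trans hx)
  | succ n ih =>
    obtain ⟨U, hU, V, hV, hUV⟩ := mem_inf_iff_superset.1 h
    obtain ⟨W, hW, hWV⟩ := mem_comap.1 hV
    have h1 := (eventually_eventually_nhdsLE hU).filter_mono
      (inf_le_left (b := comap cbRank (nbhd n (cbRank a))))
    have h2 := ((ih hW).comap cbRank).filter_mono (inf_le_right (a := 𝓝[≤] a))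
    filter_upwards [h1, h2] with x hx1 hx2
    exact mem_inf_iff_superset.2 ⟨U, hx1, V, mem_of_superset (preimage_mem_comap hx2) hWV, hUV⟩

/-- The derived-set operator of the `n`-th topology. -/
def deriv (n : ℕ) (A : Set Ordinal.{0}) : Set Ordinal.{0} :=
  {a | ∃ᶠ x in nbhd n a, x < a ∧ x ∈ A}

theorem deriv_mono {n : ℕ} {A B : Set Ordinal.{0}} (h : A ⊆ B) : deriv n A ⊆ deriv n B :=
  fun _ ha => Frequently.mono ha fun _ hx => ⟨hx.1, h hx.2⟩

theorem deriv_antitone {m n : ℕ} (h : m ≤ n) (A : Set Ordinal.{0}) : deriv n A ⊆ deriv m A :=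
  fun a ha => Frequently.filter_mono ha (nbhd_antitone a h)

/-- Löb's axiom holds because derived sets only look at smaller ordinals: a least counterexample
would be a limit of smaller ones. -/
theorem deriv_loeb {n : ℕ} (A : Set Ordinal.{0}) : deriv n A ⊆ deriv n (A \ deriv n A) := by
  intro a ha
  by_contra hna
  have hp : ∀ᶠ x in nbhd n a, x < a → x ∈ A → x ∈ deriv n A := by
    filter_upwards [not_frequently.1 hna] with x hx h1 h2
    by_contra h3
    exact hx ⟨h1, h2, h3⟩
  set p : Ordinal.{0} → Prop := fun x => x < a → x ∈ A → x ∈ deriv n A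
  have hne : {x | x < a ∧ x ∈ A ∧ p x ∧ ∀ᶠ y in nbhd n x, p y}.Nonempty := by
    obtain ⟨x, hx, hx'⟩ := (ha.and_eventually (hp.and (eventually_eventually_nbhd hp))).exists
    exact ⟨x, hx.1, hx.2, hx'⟩
  obtain ⟨x, ⟨hxa, hxA, hpx, hqx⟩, hmin⟩ := WellFounded.has_min wellFounded_lt _ hne
  obtain ⟨y, ⟨hyx, hyA⟩, hpy, hqy⟩ := ((hpx hxa hxA : x ∈ deriv n A).and_eventually
    (hqx.and (eventually_eventually_nbhd hqx))).exists
  exact hmin y ⟨hyx.trans hxa, hyA, hpy, hqy⟩ hyx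

theorem mem_deriv_zero {a : Ordinal.{0}} {A : Set Ordinal.{0}} :
    a ∈ deriv 0 A ↔ ∃ x < a, x ∈ A := by
  simp only [deriv, nbhd, mem_ofPred_eq, frequently_principal, mem_Iic]
  exact ⟨fun ⟨x, h⟩ => ⟨x, h.2⟩, fun ⟨x, h⟩ => ⟨x, h.1.le, h⟩⟩

/-- `cbRank` behaves like a d-map: just below `a` ranks drop under `cbRank a`, while every smaller
rank recurs arbitrarily close to `a`. -/
theorem mem_deriv_succ_preimage {n : ℕ} {a : Ordinal.{0}} {P : Set Ordinal.{0}} :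
    a ∈ deriv (n + 1) (cbRank ⁻¹' P) ↔ cbRank a ∈ deriv n P := by
  rcases eq_zero_or_pos a with rfl | ha
  · have h0 : cbRank 0 = 0 := le_antisymm (cbRank_le 0) bot_le
    constructor
    · intro h
      obtain ⟨x, hx, -⟩ := h.exists
      exact absurd hx not_lt_bot
    · intro h
      rw [h0] at h
      obtain ⟨x, hx, -⟩ := h.exists
      exact absurd hx not_lt_bot
  obtain ⟨c, hc, hca⟩ := exists_cbRank_lt ha
  constructor
  · intro h hn
    have h1 : ∀ᶠ x in nbhd (n + 1) a, c < x :=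
      ((eventually_nhdsLE_iff ha).2 ⟨c, hc, fun x _ hx => hx⟩).filter_mono inf_le_left
    have h2 := (hn.comap cbRank).filter_mono (inf_le_right (a := 𝓝[≤] a))
    obtain ⟨x, ⟨hx, hxP⟩, hx1, hx2⟩ := (h.and_eventually (h1.and h2)).exists
    exact hx2 ⟨hca x hx hx1, hxP⟩
  · intro h hn
    obtain ⟨U, hU, V, hV, hUV⟩ := mem_inf_iff_superset.1 hn
    obtain ⟨W, hW, hWV⟩ := mem_comap.1 hV
    obtain ⟨b, hb, hbU⟩ := (eventually_nhdsLE_iff ha).1 hU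
    obtain ⟨y, ⟨hy, hyP⟩, hyW⟩ := (h.and_eventually hW).exists
    obtain ⟨x, hbx, hxa, rfl⟩ := exists_cbRank_eq hy hb
    exact hUV ⟨hbU x hxa.le hbx, hWV hyW⟩ ⟨hxa, hyP⟩

theorem mem_deriv_succ_congr {n : ℕ} {a : Ordinal.{0}} {A B : Set Ordinal.{0}}
    (h : ∀ᶠ x in 𝓝[≤] a, (x ∈ A ↔ x ∈ B)) : a ∈ deriv (n + 1) A ↔ a ∈ deriv (n + 1) B := by
  have h' : ∀ᶠ x in nbhd (n + 1) a, (x ∈ A ↔ x ∈ B) := h.filter_mono inf_le_left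
  exact frequently_congr (h'.mono fun x hx => by rw [hx])

/-- Sets that are, locally in the left order topology, preimages under `cbRank` of sets
of the same kind, to depth `k`. -/
def Tame : ℕ → Set Ordinal.{0} → Prop
  | 0, _ => True
  | k + 1, A => ∀ a, ∃ P, Tame k P ∧ ∀ᶠ x in 𝓝[≤] a, (x ∈ A ↔ cbRank x ∈ P)

theorem tame_const (k : ℕ) (p : Prop) : Tame k {_x | p} := by
  induction k with
  | zero => trivial
  | succ k ih => exact fun a => ⟨_, ih, .of_forall fun x => Iff.rfl⟩

theorem Tame.imp {k : ℕ} {A B : Set Ordinal.{0}} (hA : Tame k A) (hB : Tame k B) :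
    Tame k {x | x ∈ A → x ∈ B} := by
  induction k generalizing A B with
  | zero => trivial
  | succ k ih =>
    intro a
    obtain ⟨P, hP, hAP⟩ := hA a
    obtain ⟨Q, hQ, hBQ⟩ := hB a
    refine ⟨_, ih hP hQ, ?_⟩
    filter_upwards [hAP, hBQ] with x h1 h2
    simp only [h1, h2]

theorem Tame.compl {k : ℕ} {A : Set Ordinal.{0}} (hA : Tame k A) : Tame k Aᶜ :=
  hA.imp (tame_const k False)

theorem mem_deriv_succ_of_local {n : ℕ} {a : Ordinal.{0}} {A P : Set Ordinal.{0}}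
    (h : ∀ᶠ x in 𝓝[≤] a, (x ∈ A ↔ cbRank x ∈ P)) :
    a ∈ deriv (n + 1) A ↔ cbRank a ∈ deriv n P := by
  rw [← mem_deriv_succ_preimage]
  exact mem_deriv_succ_congr h

theorem Tame.deriv {k : ℕ} (n : ℕ) {A : Set Ordinal.{0}} (hA : Tame k A) :
    Tame k (deriv n A) := by
  induction k generalizing n A with
  | zero => trivial
  | succ k ih =>
    intro a
    rcases n with _ | n
    -- `deriv 0 A` is upward closed, hence constant on a left neighbourhood of `a`.
    · refine ⟨_, tame_const k (a ∈ GLP.deriv 0 A), ?_⟩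
      by_cases ha : a ∈ GLP.deriv 0 A
      · obtain ⟨b, hb, hbA⟩ := mem_deriv_zero.1 ha
        refine (eventually_nhdsLE_iff (bot_le.trans_lt hb)).2 ⟨b, hb, fun x _ hbx => ?_⟩
        exact iff_of_true (mem_deriv_zero.2 ⟨b, hbx, hbA⟩) ha
      · filter_upwards [self_mem_nhdsWithin] with x hx
        refine iff_of_false (fun h => ha ?_) ha
        obtain ⟨b, hb, hbA⟩ := mem_deriv_zero.1 h
        exact mem_deriv_zero.2 ⟨b, hb.trans_le hx, hbA⟩
    · obtain ⟨P, hP, hAP⟩ := hA a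
      exact ⟨_, ih n hP, (eventually_eventually_nhdsLE hAP).mono fun x hx =>
        mem_deriv_succ_of_local hx⟩

/-- Negative introspection in the model: derived sets are open in the next topology. The base case
is upward closure, and local preimages under `cbRank` reduce `n + 1` to `n`. -/
theorem Tame.eventually_mem_deriv {n : ℕ} {A : Set Ordinal.{0}} (hA : Tame n A)
    {a : Ordinal.{0}} (ha : a ∈ GLP.deriv n A) : ∀ᶠ x in nbhd (n + 1) a, x ∈ GLP.deriv n A := by
  induction n generalizing A a with
  | zero =>
    obtain ⟨b, hb, hbA⟩ := mem_deriv_zero.1 ha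
    refine Filter.Eventually.filter_mono inf_le_left
      ((eventually_nhdsLE_iff (bot_le.trans_lt hb)).2 ⟨b, hb, fun x _ hbx => ?_⟩)
    exact mem_deriv_zero.2 ⟨b, hbx, hbA⟩
  | succ n ih =>
    obtain ⟨P, hP, hAP⟩ := hA a
    have h1 := ((ih hP ((mem_deriv_succ_of_local hAP).1 ha)).comap cbRank).filter_mono
      (inf_le_right (a := 𝓝[≤] a))
    have h2 := (eventually_eventually_nhdsLE hAP).filter_mono
      (inf_le_left (b := comap cbRank (nbhd (n + 1) (cbRank a))))
    filter_upwards [h1, h2] with x hx1 hx2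
    exact (mem_deriv_succ_of_local hx2).2 hx1

/-! ## Soundness and consistency of worms -/

/-- The truth set of a formula, with `[α]` read in the `f α`-th topology. -/
def eval (f : Ordinal.{u} → ℕ) : Formula.{u} → Set Ordinal.{0}
  | .var _ => ∅
  | .bot => ∅
  | .imp φ ψ => {x | x ∈ eval f φ → x ∈ eval f ψ}
  | .box α φ => (deriv (f α) (eval f φ)ᶜ)ᶜ

theorem eval_neg (f : Ordinal.{u} → ℕ) (φ : Formula.{u}) :
    eval f φ.neg = (eval f φ)ᶜ := rfl

theorem eval_dia (f : Ordinal.{u} → ℕ) (α : Ordinal.{u}) (φ : Formula.{u}) :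
    eval f (φ.dia α) = deriv (f α) (eval f φ) := by
  simp only [Formula.dia, eval_neg, eval, compl_compl]

theorem tame_eval (f : Ordinal.{u} → ℕ) (φ : Formula.{u}) (k : ℕ) : Tame k (eval f φ) := by
  induction φ with
  | var n => exact tame_const k False
  | bot => exact tame_const k False
  | imp φ ψ h1 h2 => exact h1.imp h2
  | box α φ ih => exact (ih.compl.deriv (f α)).compl

theorem eval_eq_truth (f : Ordinal.{u} → ℕ) (φ : Formula.{u}) (x : Ordinal.{0}) :
    x ∈ eval f φ ↔ φ.Truth fun ψ => x ∈ eval f ψ := by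
  induction φ with
  | var n => rfl
  | bot => rfl
  | imp φ ψ h1 h2 => exact imp_congr h1 h2
  | box α φ ih => rfl

theorem Provable.sound {φ : Formula.{u}} (h : Provable φ) :
    ∃ M : Finset Ordinal.{u}, ∀ f : Ordinal.{u} → ℕ, StrictMonoOn f M → ∀ x, x ∈ eval f φ := by
  induction h with
  | taut h => exact ⟨∅, fun f _ x => (eval_eq_truth f _ x).2 (h _)⟩
  | distr α χ ψ =>
    refine ⟨∅, fun f _ x h1 h2 h3 => ?_⟩
    have : ¬ ∃ᶠ y in nbhd (f α) x, (y < x ∧ y ∈ (eval f (.imp χ ψ))ᶜ) ∨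
        (y < x ∧ y ∈ (eval f χ)ᶜ) := by
      rw [frequently_or_distrib]
      exact not_or.2 ⟨h1, h2⟩
    refine this (Frequently.mono h3 fun y hy => ?_)
    by_cases hχ : y ∈ eval f χ
    · exact Or.inl ⟨hy.1, fun h => hy.2 (h hχ)⟩
    · exact Or.inr ⟨hy.1, hχ⟩
  | loeb α χ =>
    refine ⟨∅, fun f _ x h1 h2 => h1 (deriv_mono ?_ (deriv_loeb _ h2))⟩
    exact fun y hy h => hy.1 (h hy.2)
  | @negIntro α β h ψ =>
    refine ⟨{α, β}, fun f hf x => ?_⟩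
    have hlt : f α < f β := hf (by simp) (by simp) h
    change _ → _
    simp only [eval, eval_dia]
    intro h1 h2
    have h3 := ((tame_eval f ψ (f α)).eventually_mem_deriv h1).filter_mono
      (nbhd_antitone x (Nat.succ_le_of_lt hlt))
    obtain ⟨y, hy, hy'⟩ := (h2.and_eventually h3).exists
    exact hy.2 hy'
  | @mono α β h ψ =>
    refine ⟨{α, β}, fun f hf x h1 h2 => h1 (deriv_antitone ?_ _ h2)⟩
    rcases h.eq_or_lt with rfl | h
    · exact le_rfl
    · exact (hf (by simp) (by simp) h).le
  | mp _ _ ih1 ih2 =>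
    classical
    obtain ⟨M, hM⟩ := ih1
    obtain ⟨N, hN⟩ := ih2
    refine ⟨M ∪ N, fun f hf x => hM f (hf.mono ?_) x (hN f (hf.mono ?_) x)⟩ <;> simp
  | nec α _ ih =>
    obtain ⟨M, hM⟩ := ih
    refine ⟨M, fun f hf x h => ?_⟩
    obtain ⟨y, hy⟩ := h.exists
    exact hy.2 (hM f hf y)

theorem mem_deriv_preimage_iterate {n : ℕ} {a : Ordinal.{0}} {P : Set Ordinal.{0}} :
    a ∈ deriv n (cbRank^[n] ⁻¹' P) ↔ cbRank^[n] a ∈ deriv 0 P := by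
  induction n generalizing a with
  | zero => rfl
  | succ n ih =>
    rw [Function.iterate_succ, Set.preimage_comp, mem_deriv_succ_preimage, ih]
    rfl

/-- Each diamond costs at most one unit of the `n`-th iterated rank, so rank `A.length` suffices. -/
theorem mem_eval_worm (f : Ordinal.{u} → ℕ) (n : ℕ) (A : Worm.{u}) (hA : ∀ α ∈ A, f α ≤ n)
    (x : Ordinal.{0}) (hx : (A.length : Ordinal.{0}) ≤ cbRank^[n] x) :
    x ∈ eval f A.toFormula := by
  induction A generalizing x with
  | nil => exact id
  | cons α A ih =>
    rw [Worm.toFormula, eval_dia]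
    refine deriv_antitone (hA α List.mem_cons_self) _ ?_
    refine deriv_mono (A := cbRank^[n] ⁻¹' {y | (A.length : Ordinal.{0}) ≤ y})
      (fun y hy => ih (fun β hβ => hA β (List.mem_cons_of_mem _ hβ)) y hy) ?_
    rw [mem_deriv_preimage_iterate, mem_deriv_zero]
    refine ⟨A.length, lt_of_lt_of_le ?_ hx, le_refl (A.length : Ordinal.{0})⟩
    exact_mod_cast Nat.lt_succ_self A.length

theorem not_provable_neg_worm (A : Worm.{u}) : ¬ Provable A.toFormula.neg := by
  classical
  intro h
  obtain ⟨M, hM⟩ := h.sound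
  -- Counting the elements of `M` below `α` is strictly increasing on `M`.
  let f : Ordinal.{u} → ℕ := fun α => (M.filter (· < α)).card
  have hf : StrictMonoOn f M := by
    intro α hα β _ hαβ
    refine Finset.card_lt_card (Finset.ssubset_iff_of_subset ?_ |>.2 ⟨α, ?_, ?_⟩)
    · exact fun γ hγ => by
        simp only [Finset.mem_filter] at hγ ⊢
        exact ⟨hγ.1, hγ.2.trans hαβ⟩
    · simpa using ⟨hα, hαβ⟩
    · simp
  obtain ⟨x, hx⟩ := (cbRank_surjective.iterate M.card) A.length
  exact hM f hf x (mem_eval_worm f M.card A (fun α _ => Finset.card_filter_le _ _) x hx.ge)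

theorem not_entails_dia_worm (α : Ordinal.{u}) (A : Worm.{u}) :
    ¬ A.toFormula ⊩ A.toFormula.dia α :=
  fun h => not_provable_neg_worm A (provable_neg_of_entails_dia h)

/-! ## Worm calculus -/

section Worms

open Formula

variable {α β ξ μ ν : Ordinal.{u}} {A B C h r : Worm.{u}} {φ : Formula.{u}}

theorem MemS.mono (hA : MemS β A) (h : α ≤ β) : MemS α A := fun γ hγ => h.trans (hA γ hγ)

theorem memS_cons : MemS α (β :: A) ↔ α ≤ β ∧ MemS α A := List.forall_mem_cons

theorem memS_append : MemS α (A ++ B) ↔ MemS α A ∧ MemS α B := List.forall_mem_append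

theorem memS_zero (A : Worm.{u}) : MemS 0 A := fun _ _ => bot_le

theorem append_entails_left (A B : Worm.{u}) :
    Worm.toFormula (A ++ B) ⊩ Worm.toFormula A := by
  induction A with
  | nil => exact entails_top _
  | cons α A ih => exact ih.dia α

theorem append_entails_right (hA : MemS α A) (B : Worm.{u}) :
    Worm.toFormula (A ++ α :: B) ⊩ dia α (Worm.toFormula B) := by
  induction A with
  | nil => exact .refl _
  | cons β A ih =>
    obtain ⟨h1, h2⟩ := memS_cons.1 hA
    exact (((ih h2).dia β).trans (dia_anti h1 _)).trans (dia_dia _ _)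

theorem and_dia_entails_append (hA : MemS (α + 1) A) (B : Worm.{u}) :
    and (Worm.toFormula A) (dia α (Worm.toFormula B)) ⊩ Worm.toFormula (A ++ α :: B) := by
  induction A with
  | nil => exact and_right _ _
  | cons β A ih =>
    obtain ⟨h1, h2⟩ := memS_cons.1 hA
    exact (dia_and (Order.add_one_le_iff.1 h1) _ _).trans ((ih h2).dia β)

theorem entails_append (hA : MemS (α + 1) A) (h1 : φ ⊩ Worm.toFormula A)
    (h2 : φ ⊩ dia α (Worm.toFormula B)) : φ ⊩ Worm.toFormula (A ++ α :: B) :=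
  (h1.and h2).trans (and_dia_entails_append hA B)

theorem entails_dia_append (hβ : α < β) (hA : MemS (α + 1) A)
    (h1 : φ ⊩ dia β (Worm.toFormula A)) (h2 : φ ⊩ dia α (Worm.toFormula B)) :
    φ ⊩ dia β (Worm.toFormula (A ++ α :: B)) :=
  (h1.and h2).trans ((dia_and hβ _ _).trans ((and_dia_entails_append hA B).dia β))

theorem WLt.trans (h1 : WLt α A B) (h2 : WLt α B C) : WLt α A C :=
  Entails.trans h2 ((Entails.dia α h1).trans (dia_dia _ _))

theorem WLt.anti (h : α ≤ β) (h1 : WLt β A B) : WLt α A B := Entails.trans h1 (dia_anti h _)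

theorem not_wlt_self (α : Ordinal.{u}) (A : Worm.{u}) : ¬ WLt α A A :=
  not_entails_dia_worm α A

/-! ### Heads and the comparison of worms -/

theorem head_memS (ξ : Ordinal.{u}) (A : Worm.{u}) : MemS ξ (head ξ A) := by
  induction A with
  | nil => exact fun β hβ => absurd hβ List.not_mem_nil
  | cons β A ih =>
    rw [head]
    split_ifs with h
    · exact memS_cons.2 ⟨h, ih⟩
    · exact fun β hβ => absurd hβ List.not_mem_nil

theorem head_eq_self (hA : MemS ξ A) : head ξ A = A := by
  induction A with
  | nil => rfl
  | cons β A ih =>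
    obtain ⟨h1, h2⟩ := memS_cons.1 hA
    rw [head, if_pos h1, ih h2]

theorem head_append_of_lt (hμ : μ < ξ) (A B : Worm.{u}) :
    head ξ (A ++ μ :: B) = head ξ A := by
  induction A with
  | nil => simp [head, hμ]
  | cons β A ih => rw [List.cons_append, head, head, ih]

theorem head_prefix (ξ : Ordinal.{u}) (A : Worm.{u}) : head ξ A <+: A := by
  induction A with
  | nil => exact List.prefix_rfl
  | cons β A ih =>
    rw [head]
    split_ifs with h
    · exact List.cons_prefix_cons.2 ⟨rfl, ih⟩
    · exact List.nil_prefix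

theorem entails_head (ξ : Ordinal.{u}) (A : Worm.{u}) :
    A.toFormula ⊩ (head ξ A).toFormula := by
  obtain ⟨B, hB⟩ := head_prefix ξ A
  conv_lhs => rw [← hB]
  exact append_entails_left _ _

theorem memS_or_eq_head_append (ξ : Ordinal.{u}) (A : Worm.{u}) :
    MemS ξ A ∨ ∃ ν < ξ, ∃ r, A = head ξ A ++ ν :: r := by
  induction A with
  | nil => exact Or.inl fun β hβ => absurd hβ List.not_mem_nil
  | cons β A ih =>
    rw [head]
    split_ifs with h
    · rcases ih with ih | ⟨ν, hν, r, hr⟩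
      · exact Or.inl (memS_cons.2 ⟨h, ih⟩)
      · exact Or.inr ⟨ν, hν, r, by rw [List.cons_append, ← hr]⟩
    · exact Or.inr ⟨β, not_le.1 h, A, rfl⟩

theorem memS_succ_or_eq_head_append (hA : MemS μ A) :
    MemS (μ + 1) A ∨ ∃ r, MemS μ r ∧ A = head (μ + 1) A ++ μ :: r := by
  refine (memS_or_eq_head_append (μ + 1) A).imp_right ?_
  rintro ⟨ν, hν, r, hr⟩
  rw [hr] at hA
  obtain ⟨h1, h2⟩ := memS_cons.1 (memS_append.1 hA).2
  obtain rfl := le_antisymm h1 (Order.lt_add_one_iff.1 hν)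
  exact ⟨r, h2, hr⟩

theorem not_memS_succ (h : μ ∈ A) : ¬ MemS (μ + 1) A :=
  fun hA => (Order.add_one_le_iff.1 (hA μ h)).false

theorem exists_mem_memS (hA : A ≠ []) : ∃ μ ∈ A, MemS μ A := by
  obtain ⟨μ, h1, h2⟩ := WellFounded.has_min (wellFounded_lt (α := Ordinal.{u})) {β | β ∈ A}
    (List.exists_mem_of_ne_nil A hA)
  exact ⟨μ, h1, fun β hβ => not_lt.1 (h2 β hβ)⟩

theorem exists_eq_head_append (hA : A ≠ []) : ∃ μ h r, MemS (μ + 1) h ∧ MemS μ r ∧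
    A = h ++ μ :: r := by
  obtain ⟨μ, h1, h2⟩ := exists_mem_memS hA
  obtain ⟨r, hr, h⟩ := (memS_succ_or_eq_head_append h2).resolve_left (not_memS_succ h1)
  exact ⟨μ, _, r, head_memS _ _, hr, h⟩

/-- Trichotomy of `<_ξ` on `S_ξ` modulo provable equivalence. -/
theorem wlt_trichotomy (hA : MemS ξ A) (hB : MemS ξ B) :
    WLt ξ A B ∨ (A.toFormula ⊩ B.toFormula ∧ B.toFormula ⊩ A.toFormula) ∨ WLt ξ B A := by
  induction hn : A.length + B.length using Nat.strong_induction_on generalizing ξ A B with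
  | _ n ih =>
  by_cases hnil : A ++ B = []
  · obtain ⟨rfl, rfl⟩ := List.append_eq_nil_iff.1 hnil
    exact Or.inr (Or.inl ⟨.refl _, .refl _⟩)
  obtain ⟨μ, hμ, hμS⟩ := exists_mem_memS hnil
  have hξ : ξ ≤ μ := memS_append.2 ⟨hA, hB⟩ μ hμ
  suffices hs : WLt μ A B ∨ (A.toFormula ⊩ B.toFormula ∧ B.toFormula ⊩ A.toFormula) ∨
      WLt μ B A from hs.imp (WLt.anti hξ) (Or.imp_right (WLt.anti hξ))
  obtain ⟨hA', hB'⟩ := memS_append.1 hμS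
  -- Comparing `X` with the remainder of `Y` after its head either puts `X` below `Y` at once, or
  -- lets a comparison of `X` with the head of `Y` lift to all of `Y`.
  have key : ∀ X Y : Worm.{u}, X.length + Y.length = n → MemS μ X → MemS μ Y → WLt μ X Y ∨
      ((X.toFormula ⊩ (head (μ + 1) Y).toFormula → X.toFormula ⊩ Y.toFormula) ∧
        (WLt (μ + 1) (head (μ + 1) Y) X → WLt (μ + 1) Y X)) := by
    intro X Y hXY hX hY
    rcases memS_succ_or_eq_head_append hY with h | ⟨r, hr, h⟩
    · rw [head_eq_self h]
      exact Or.inr ⟨id, id⟩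
    · have hlen : r.length < Y.length := by
        have := congrArg List.length h
        simp only [List.length_append, List.length_cons] at this
        omega
      have hYr : WLt μ r Y := by
        have := append_entails_right ((head_memS (μ + 1) Y).mono le_self_add) r
        rwa [← h] at this
      rcases ih _ (by omega) hX hr rfl with h1 | h1 | h1
      · exact Or.inl (h1.trans hYr)
      · exact Or.inl (Entails.trans hYr (h1.2.dia μ))
      · refine Or.inr ⟨fun h2 => ?_, fun h2 => ?_⟩
        · rw [h]
          exact entails_append (head_memS _ _) h2 h1
        · rw [h]
          exact entails_dia_append (Order.lt_add_one_iff.2 le_rfl) (head_memS _ _) h2 h1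
  rcases key A B hn hA' hB' with h1 | ⟨h1, h2⟩
  · exact Or.inl h1
  rcases key B A (by omega) hB' hA' with h3 | ⟨h3, h4⟩
  · exact Or.inr (Or.inr h3)
  -- `μ` occurs in `A` or `B` but in neither head, so the heads are shorter in total and the
  -- induction applies at level `μ + 1`.
  have hlen : (head (μ + 1) A).length + (head (μ + 1) B).length < n := by
    have hle := fun X : Worm.{u} => (head_prefix (μ + 1) X).length_le
    have hne : ∀ X : Worm.{u}, μ ∈ X → (head (μ + 1) X).length ≠ X.length := fun X hX he =>
      not_memS_succ hX ((head_prefix (μ + 1) X).eq_of_length he ▸ head_memS (μ + 1) X)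
    have := hle A
    have := hle B
    rcases List.mem_append.1 hμ with h | h
    · have := hne A h
      omega
    · have := hne B h
      omega
  rcases ih _ hlen (head_memS (μ + 1) A) (head_memS (μ + 1) B) rfl with h | h | h
  · exact Or.inl ((h4 (Entails.trans (entails_head _ _) h)).anti le_self_add)
  · exact Or.inr (Or.inl ⟨h1 ((entails_head _ _).trans h.1), h3 ((entails_head _ _).trans h.2)⟩)
  · exact Or.inr (Or.inr ((h2 (Entails.trans (entails_head _ _) h)).anti le_self_add))

/-- If `A` implied `⟨ξ⟩` of its head, the part of `A` after the head, being introduced by some `ν <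
ξ`, could be pulled under `⟨ξ⟩`, giving `A <_ξ A`. -/
theorem not_wlt_head (ξ : Ordinal.{u}) (A : Worm.{u}) : ¬ WLt ξ (head ξ A) A := by
  intro h
  rcases memS_or_eq_head_append ξ A with h1 | ⟨ν, hν, r, hr⟩
  · rw [head_eq_self h1] at h
    exact not_wlt_self _ _ h
  · refine not_wlt_self ξ A ?_
    have hS : MemS (ν + 1) (head ξ A) := (head_memS ξ A).mono (Order.add_one_le_iff.2 hν)
    have h2 : A.toFormula ⊩ dia ν (Worm.toFormula r) := by
      have := append_entails_right (hS.mono le_self_add) r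
      rwa [← hr] at this
    have := entails_dia_append hν hS h h2
    rwa [← hr] at this

theorem WLt.head (h : WLt ξ A B) : WLt ξ (head ξ A) (GLP.head ξ B) := by
  have h1 : WLt ξ (GLP.head ξ A) B := Entails.trans h ((entails_head ξ A).dia ξ)
  rcases wlt_trichotomy (head_memS ξ A) (head_memS ξ B) with h2 | h2 | h2
  · exact h2
  · exact absurd (Entails.trans h1 (h2.1.dia ξ)) (not_wlt_head ξ B)
  · exact absurd (h2.trans h1) (not_wlt_head ξ B)

theorem wequiv_iff : WEquiv A B ↔ A.toFormula ⊩ B.toFormula ∧ B.toFormula ⊩ A.toFormula :=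
  provable_iff

/-! ## Well-foundedness -/

/-- `A ≤_0 B`, with the equivalence weakened to an implication. -/
def WeakLe (A B : Worm.{u}) : Prop := B.toFormula ⊩ A.toFormula ∨ WLt 0 A B

theorem WeakLe.trans (h1 : WeakLe A B) (h2 : WeakLe B C) : WeakLe A C := by
  rcases h1 with h1 | h1 <;> rcases h2 with h2 | h2
  · exact Or.inl (h2.trans h1)
  · exact Or.inr (Entails.trans h2 (h1.dia 0))
  · exact Or.inr (Entails.trans h2 h1)
  · exact Or.inr (h1.trans h2)

instance : IsPreorder Worm.{u} WeakLe where
  refl _ := Or.inl (.refl _)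
  trans _ _ _ := WeakLe.trans

theorem WeakLe.not_wlt (h : WeakLe A B) : ¬ WLt 0 B A := by
  intro h'
  rcases h with h | h
  · exact not_wlt_self 0 B (Entails.trans h h')
  · exact not_wlt_self 0 B (h'.trans h)

theorem WeakLe.entails_or (hA : MemS ξ A) (hB : MemS ξ B) (h : WeakLe A B) :
    B.toFormula ⊩ A.toFormula ∨ WLt ξ A B := by
  rcases wlt_trichotomy hA hB with h1 | h1 | h1
  · exact Or.inr h1
  · exact Or.inl h1.2
  · exact absurd (h1.anti bot_le) h.not_wlt

/-- This makes worms a well-quasi-order: `μ`, head and remainder may be compared independently. -/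
theorem WeakLe.append {A' B' : Worm.{u}} (hμ : μ ≤ ν) (hA : MemS (μ + 1) A) (hA' : MemS (ν + 1) A')
    (hB : MemS μ B) (hB' : MemS ν B') (h1 : WeakLe A A') (h2 : WeakLe B B') :
    WeakLe (A ++ μ :: B) (A' ++ ν :: B') := by
  have h3 : Worm.toFormula (A' ++ ν :: B') ⊩ dia μ B.toFormula := by
    refine ((append_entails_right (hA'.mono le_self_add) B').trans (dia_anti hμ _)).trans ?_
    rcases h2.entails_or hB (hB'.mono hμ) with h | h
    · exact h.dia μ
    · exact (Entails.dia μ h).trans (dia_dia _ _)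
  rcases h1.entails_or hA (hA'.mono (by gcongr)) with h | h
  · exact Or.inl (entails_append hA ((append_entails_left _ _).trans h) h3)
  · have h4 := entails_dia_append (Order.lt_add_one_iff.2 le_rfl) hA
      ((append_entails_left A' (ν :: B')).trans h) h3
    exact Or.inr (WLt.anti bot_le h4)

open Set.PartiallyWellOrderedOn in
theorem partiallyWellOrderedOn_range_of_isMinBadSeq {f e : ℕ → Worm.{u}}
    (hf : IsBadSeq WeakLe Set.univ f)
    (hmin : ∀ n, IsMinBadSeq WeakLe List.length Set.univ n f)
    (hlen : ∀ n, (e n).length < (f n).length) (hle : ∀ n, WeakLe (e n) (f n)) :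
    (Set.range e).PartiallyWellOrderedOn WeakLe := by
  rw [Set.partiallyWellOrderedOn_iff_exists_lt]
  intro s hs
  choose k hk using hs
  obtain ⟨i₀, hi₀⟩ : ∃ i₀, ∀ i, k i₀ ≤ k i := by
    obtain ⟨_, ⟨i₀, rfl⟩, h⟩ := WellFounded.has_min (wellFounded_lt (α := ℕ)) (Set.range k)
      ⟨_, 0, rfl⟩
    exact ⟨i₀, fun i => not_lt.1 (h _ ⟨i, rfl⟩)⟩
  -- Splice: `f` before the least index `k i₀`, then `s` from `i₀` on. By minimality this sequence
  -- has a good pair; one starting inside `f` would yield a good pair of `f`, so both members come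
  -- from `s`.
  have h := hmin (k i₀) (fun n => if n < k i₀ then f n else s (i₀ + (n - k i₀)))
    (fun m hm => (if_pos hm).symm) (by simpa [← hk] using hlen (k i₀))
  rw [IsBadSeq] at h
  push Not at h
  obtain ⟨m, n, hmn, hQ⟩ := h fun n => Set.mem_univ _
  by_cases hn : n < k i₀
  · rw [if_pos hn, if_pos (hmn.trans hn)] at hQ
    exact absurd hQ (hf.2 m n hmn)
  · rw [if_neg hn] at hQ
    by_cases hm : m < k i₀
    · rw [if_pos hm, ← hk] at hQ
      exact absurd (hQ.trans (hle _)) (hf.2 m _ (hm.trans_le (hi₀ _)))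
    · rw [if_neg hm] at hQ
      exact ⟨_, _, by omega, hQ⟩

open Set.PartiallyWellOrderedOn in
theorem partiallyWellOrderedOn_weakLe :
    (Set.univ : Set Worm.{u}).PartiallyWellOrderedOn WeakLe := by
  rw [iff_not_exists_isMinBadSeq List.length]
  rintro ⟨f, hf, hmin⟩
  have hnil : ∀ n, f n ≠ [] := fun n hn =>
    hf.2 n (n + 1) n.lt_succ_self (Or.inl (by rw [hn]; exact entails_top _))
  choose μ h r hh hr hf' using fun n => exists_eq_head_append (hnil n)
  have hH := partiallyWellOrderedOn_range_of_isMinBadSeq (e := h) hf hmin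
    (fun n => by rw [hf' n]; simp)
    (fun n => Or.inl (by conv_lhs => rw [hf' n]
                         exact append_entails_left _ _))
  have hR := partiallyWellOrderedOn_range_of_isMinBadSeq (e := r) hf hmin
    (fun n => by rw [hf' n]; simp; omega)
    (fun n => Or.inr (by
      rw [hf' n]
      exact WLt.anti bot_le (append_entails_right ((hh n).mono le_self_add) _)))
  have hM : (Set.univ : Set Ordinal.{u}).PartiallyWellOrderedOn (· ≤ ·) :=
    Set.isPWO_univ_iff.2 inferInstance
  obtain ⟨m, n, hmn, h1, h2, h3⟩ := (hM.prod (hH.prod hR)).exists_lt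
    (f := fun n => (μ n, h n, r n))
    (fun n => ⟨Set.mem_univ _, Set.mem_range_self n, Set.mem_range_self n⟩)
  refine hf.2 m n hmn ?_
  rw [hf' m, hf' n]
  exact WeakLe.append h1 (hh m) (hh n) (hr m) (hr n) h2 h3

theorem wellFounded_wlt (α : Ordinal.{u}) : WellFounded (WLt α) := by
  have : IsTrans Worm.{u} (WLt 0) := ⟨fun _ _ _ h1 h2 => h1.trans h2⟩
  have : Std.Irrefl (WLt.{u} 0) := ⟨not_wlt_self 0⟩
  have : IsStrictOrder Worm.{u} (WLt 0) := { }
  have h0 : WellFounded (WLt.{u} 0) := by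
    rw [RelEmbedding.wellFounded_iff_isEmpty]
    refine ⟨fun g => ?_⟩
    obtain ⟨m, n, hmn, h⟩ := partiallyWellOrderedOn_weakLe.exists_lt (f := g)
      fun n => Set.mem_univ _
    exact h.not_wlt (g.map_rel_iff.2 hmn)
  exact Subrelation.wf (fun h => WLt.anti bot_le h) h0

theorem wellFounded_slt (α : Ordinal.{u}) : WellFounded (SLt α) :=
  Subrelation.wf (fun h => h.2.2) (wellFounded_wlt α)

end Worms

/-! ## Ranks -/

theorem rk_lt {X : Type u} {r : X → X → Prop} (hr : WellFounded r) {a b : X} (h : r b a) :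
    rk r b < rk r a := by
  rw [rk_eq hr a]
  exact (Order.lt_add_one_iff.2 le_rfl).trans_le
    (Ordinal.le_iSup (fun b : {b // r b a} => rk r b.1 + 1) ⟨b, h⟩)

theorem rk_le_of_map {X Y : Type u} {r : X → X → Prop} {s : Y → Y → Prop} (hr : WellFounded r)
    (hs : WellFounded s) (f : X → Y) (h : ∀ b c, r b c → s (f b) (f c)) (a : X) :
    rk r a ≤ rk s (f a) := by
  induction a using hr.induction with
  | _ a ih =>
    rw [rk_eq hr]
    exact Ordinal.iSup_le fun b =>
      Order.add_one_le_iff.2 ((ih b.1 b.2).trans_lt (rk_lt hs (h _ _ b.2)))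

theorem rk_mono {X : Type u} {r : X → X → Prop} (hr : WellFounded r) {a a' : X}
    (h : ∀ b, r b a → r b a') : rk r a ≤ rk r a' := by
  rw [rk_eq hr a]
  exact Ordinal.iSup_le fun b => Order.add_one_le_iff.2 (rk_lt hr (h _ b.2))

/-- Taking heads is order preserving into `S_ξ`, which bounds the left side; conversely `A` implies
its head, so whatever lies below the head lies below `A`. -/
theorem Omega_eq_o_head (ξ : Ordinal.{u}) (A : Worm.{u}) : Omega ξ A = o ξ (head ξ A) := by
  refine le_antisymm ?_ ?_
  · exact rk_le_of_map (wellFounded_wlt ξ) (wellFounded_slt ξ) (head ξ)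
      (fun B C h => ⟨head_memS _ _, head_memS _ _, h.head⟩) A
  · refine (rk_le_of_map (wellFounded_slt ξ) (wellFounded_wlt ξ) id (fun B C h => h.2.2) _).trans ?_
    exact rk_mono (wellFounded_wlt ξ) fun B h => Entails.trans (entails_head ξ A) h

/-! ## Shifting modalities -/

section Shift

open Formula

variable {α β ξ μ ν : Ordinal.{u}} {A B : Worm.{u}}

/-- Rename the modalities of a formula. -/
def Formula.relabel (f : Ordinal.{u} → Ordinal.{u}) : Formula.{u} → Formula.{u}
  | var n => var n
  | bot => bot
  | imp φ ψ => imp (relabel f φ) (relabel f ψ)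
  | box α φ => box (f α) (relabel f φ)

theorem truth_relabel (f : Ordinal.{u} → Ordinal.{u}) (v : Formula.{u} → Prop)
    (φ : Formula.{u}) : (φ.relabel f).Truth v ↔ φ.Truth fun ψ => v (ψ.relabel f) := by
  induction φ with
  | var n => rfl
  | bot => rfl
  | imp φ ψ h1 h2 => exact imp_congr h1 h2
  | box α φ ih => rfl

theorem Provable.relabel {f : Ordinal.{u} → Ordinal.{u}} (hf : StrictMono f) {φ : Formula.{u}}
    (h : Provable φ) : Provable (φ.relabel f) := by
  induction h with
  | taut h => exact .taut fun v => (truth_relabel f v _).2 (h _)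
  | distr α χ ψ => exact .distr _ _ _
  | loeb α χ => exact .loeb _ _
  | negIntro h ψ => exact .negIntro (hf h) _
  | mono h ψ => exact .mono (hf.monotone h) _
  | mp _ _ h1 h2 => exact .mp h1 h2
  | nec α _ h => exact .nec _ h

theorem relabel_toFormula (f : Ordinal.{u} → Ordinal.{u}) (A : Worm.{u}) :
    A.toFormula.relabel f = Worm.toFormula (A.map f) := by
  induction A with
  | nil => rfl
  | cons α A ih => rw [List.map_cons, Worm.toFormula, Worm.toFormula, ← ih]; rfl

theorem WLt.relabel {f : Ordinal.{u} → Ordinal.{u}} (hf : StrictMono f) (h : WLt α A B) :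
    WLt (f α) (A.map f) (B.map f) := by
  have h' := Provable.relabel hf h
  change Provable (imp (B.toFormula.relabel f) (dia (f α) (A.toFormula.relabel f))) at h'
  rwa [relabel_toFormula, relabel_toFormula] at h'

theorem entails_relabel {f : Ordinal.{u} → Ordinal.{u}} (hf : StrictMono f)
    (h : A.toFormula ⊩ B.toFormula) :
    Worm.toFormula (A.map f) ⊩ Worm.toFormula (B.map f) := by
  have h' := Provable.relabel hf h
  change Provable (imp (A.toFormula.relabel f) (B.toFormula.relabel f)) at h'
  rwa [relabel_toFormula, relabel_toFormula] at h'

theorem strictMono_add_left (ξ : Ordinal.{u}) : StrictMono fun α => ξ + α :=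
  fun _ _ h => add_lt_add_right h ξ

theorem map_add_demote (hA : MemS ξ A) : (demote ξ A).map (fun α => ξ + α) = A := by
  rw [demote, List.map_map]
  conv_rhs => rw [← List.map_id A]
  exact List.map_congr_left fun β hβ => Ordinal.add_sub_cancel_of_le (hA β hβ)

theorem memS_demote (hξ : ξ ≤ ν) (hA : MemS ν A) : MemS (ν - ξ) (demote ξ A) := by
  intro β hβ
  obtain ⟨γ, hγ, rfl⟩ := List.mem_map.1 hβ
  have h := hA γ hγ
  rw [Ordinal.le_sub_of_le (hξ.trans h), Ordinal.add_sub_cancel_of_le hξ]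
  exact h

/-- Only the strictly monotone `ξ + ·` relabels proofs. Trichotomy for the demoted worms, lifted by
it, matches the two comparisons case by case, so demotion preserves order too. -/
theorem demote_trichotomy (hξ : ξ ≤ ν) (hA : MemS ν A) (hB : MemS ν B) :
    (WLt ν A B ∧ WLt (ν - ξ) (demote ξ A) (demote ξ B)) ∨
      (A.toFormula ⊩ B.toFormula ∧ B.toFormula ⊩ A.toFormula) ∧
        WEquiv (demote ξ A) (demote ξ B) ∨
      (WLt ν B A ∧ WLt (ν - ξ) (demote ξ B) (demote ξ A)) := by
  have hf := strictMono_add_left ξ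
  have lift : ∀ {X Y}, MemS ν X → MemS ν Y → WLt (ν - ξ) (demote ξ X) (demote ξ Y) →
      WLt ν X Y := fun hX hY h => by
    have h' := h.relabel hf
    rwa [map_add_demote (hX.mono hξ), map_add_demote (hY.mono hξ),
      Ordinal.add_sub_cancel_of_le hξ] at h'
  rcases wlt_trichotomy (memS_demote hξ hA) (memS_demote hξ hB) with h | h | h
  · exact Or.inl ⟨lift hA hB h, h⟩
  · refine Or.inr (Or.inl ⟨?_, wequiv_iff.2 h⟩)
    have h1 := entails_relabel hf h.1
    have h2 := entails_relabel hf h.2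
    rw [map_add_demote (hA.mono hξ), map_add_demote (hB.mono hξ)] at h1 h2
    exact ⟨h1, h2⟩
  · exact Or.inr (Or.inr ⟨lift hB hA h, h⟩)

theorem WLt.demote (hξ : ξ ≤ ν) (hA : MemS ν A) (hB : MemS ν B) (h : WLt ν A B) :
    WLt (ν - ξ) (demote ξ A) (GLP.demote ξ B) := by
  rcases demote_trichotomy hξ hA hB with h1 | h1 | h1
  · exact h1.2
  · exact absurd (Entails.trans h1.1.1 h) (not_wlt_self _ _)
  · exact absurd (h.trans h1.1) (not_wlt_self _ _)

theorem WLe.demote (hξ : ξ ≤ ν) (hA : MemS ν A) (hB : MemS ν B) (h : WLe ν A B) :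
    WLe (ν - ξ) (demote ξ A) (GLP.demote ξ B) := by
  rcases h with h | h
  · exact Or.inl (h.demote hξ hA hB)
  · rcases demote_trichotomy hξ hA hB with h1 | h1 | h1
    · exact Or.inl h1.2
    · exact Or.inr h1.2
    · exact absurd (Entails.trans (wequiv_iff.1 h).2 h1.1) (not_wlt_self _ _)

theorem o_eq_o_demote (hA : MemS ξ A) : o ξ A = o 0 (demote ξ A) := by
  refine le_antisymm ?_ ?_
  · refine rk_le_of_map (wellFounded_slt ξ) (wellFounded_slt 0) (demote ξ) (fun B C h => ?_) A
    have h' := h.2.2.demote le_rfl h.1 h.2.1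
    rw [Ordinal.sub_self] at h'
    exact ⟨memS_zero _, memS_zero _, h'⟩
  · have hS : ∀ B : Worm.{u}, MemS ξ (B.map fun α => ξ + α) := fun B β hβ => by
      obtain ⟨γ, -, rfl⟩ := List.mem_map.1 hβ
      exact le_self_add
    have h := rk_le_of_map (wellFounded_slt 0) (wellFounded_slt ξ) (List.map fun α => ξ + α)
      (fun B C h => ⟨hS B, hS C, by simpa using h.2.2.relabel (strictMono_add_left ξ)⟩)
      (demote ξ A)
    rwa [map_add_demote hA] at h

theorem entails_of_o_eq (h : o 0 A = o 0 B) :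
    A.toFormula ⊩ B.toFormula ∧ B.toFormula ⊩ A.toFormula := by
  have hlt : ∀ {X Y : Worm.{u}}, WLt 0 X Y → o 0 X < o 0 Y := fun h =>
    rk_lt (wellFounded_slt 0) ⟨memS_zero _, memS_zero _, h⟩
  rcases wlt_trichotomy (memS_zero A) (memS_zero B) with h1 | h1 | h1
  · exact absurd h (hlt h1).ne
  · exact h1
  · exact absurd h (hlt h1).ne'

/-! ## Normal forms -/

/-- Beklemishev normal forms, built by adding one block at a time. -/
inductive NF : Worm.{u} → Prop where
  | nil : NF []
  | join (h : Worm.{u}) (μ : Ordinal.{u}) (r : Worm.{u}) (hh : MemS (μ + 1) h) (hr : MemS μ r)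
      (nh : NF h) (nr : NF r) (hle : WLe (μ + 1) h (head (μ + 1) r)) : NF (h ++ μ :: r)

theorem BNF.nf (hA : BNF A) : NF A := by
  induction hA with
  | nil => exact .nil
  | join A α L hmin hL hA hS hB hle ih =>
    subst hA
    -- Identifying the `(α + 1)`-head with the first block turns the chain condition into the single
    -- inequality of `NF.join`.
    suffices h : ∀ (C : Worm.{u}) (L : List Worm.{u}), (∀ B ∈ C :: L, MemS (α + 1) B) →
        (∀ B ∈ C :: L, NF B) → (C :: L).IsChain (fun B C => WLe (α + 1) B C) →
        NF ([α].intercalate (C :: L)) ∧ MemS α ([α].intercalate (C :: L)) ∧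
          head (α + 1) ([α].intercalate (C :: L)) = C by
      obtain ⟨C, L, rfl⟩ := List.exists_cons_of_ne_nil hL
      exact (h C L hS ih hle).1
    clear ih hle hB hS hL hmin L
    intro C L
    induction L generalizing C with
    | nil =>
      intro hS hN _
      rw [List.intercalate_singleton]
      have hC := hS C List.mem_cons_self
      exact ⟨hN C List.mem_cons_self, hC.mono le_self_add, head_eq_self hC⟩
    | cons D L ih =>
      intro hS hN hle
      obtain ⟨h1, h2, h3⟩ := ih D (fun B hB => hS B (List.mem_cons_of_mem _ hB))
        (fun B hB => hN B (List.mem_cons_of_mem _ hB)) (List.isChain_cons_cons.1 hle).2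
      have hC := hS C List.mem_cons_self
      have he : [α].intercalate (C :: D :: L) = C ++ α :: [α].intercalate (D :: L) := by
        rw [List.intercalate_cons_cons, List.append_assoc, List.singleton_append]
      rw [he]
      refine ⟨.join _ _ _ hC h2 (hN C List.mem_cons_self) h1 ?_, ?_, ?_⟩
      · rw [h3]
        exact (List.isChain_cons_cons.1 hle).1
      · exact memS_append.2 ⟨hC.mono le_self_add, memS_cons.2 ⟨le_rfl, h2⟩⟩
      · rw [head_append_of_lt (Order.lt_add_one_iff.2 le_rfl), head_eq_self hC]

theorem NF.head (hA : NF A) (ξ : Ordinal.{u}) : NF (head ξ A) := by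
  induction hA with
  | nil => exact .nil
  | join h μ r hh hr nh nr hle ih _ =>
    rcases le_or_gt ξ μ with hμ | hμ
    · rw [head_eq_self]
      · exact .join h μ r hh hr nh nr hle
      · exact memS_append.2 ⟨(hh.mono le_self_add).mono hμ, memS_cons.2 ⟨hμ, hr.mono hμ⟩⟩
    · rwa [head_append_of_lt hμ]

theorem add_one_sub (h : ξ ≤ μ) : μ + 1 - ξ = μ - ξ + 1 := by
  conv_lhs => rw [← Ordinal.add_sub_cancel_of_le h, add_assoc, Ordinal.add_sub_cancel]

theorem head_demote (hξ : ξ ≤ ν) (hA : MemS ξ A) :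
    GLP.head (ν - ξ) (demote ξ A) = demote ξ (GLP.head ν A) := by
  induction A with
  | nil => rfl
  | cons β A ih =>
    obtain ⟨h1, h2⟩ := memS_cons.1 hA
    have hiff : ν - ξ ≤ β - ξ ↔ ν ≤ β := by
      rw [Ordinal.le_sub_of_le h1, Ordinal.add_sub_cancel_of_le hξ]
    have ih' := ih h2
    simp only [demote] at ih' ⊢
    rw [List.map_cons, GLP.head, GLP.head]
    simp only [hiff]
    split_ifs
    · rw [List.map_cons, ih']
    · rfl

theorem NF.demote (hA : NF A) (hS : MemS ξ A) : NF (demote ξ A) := by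
  induction hA with
  | nil => exact .nil
  | join h μ r hh hr nh nr hle ih1 ih2 =>
    obtain ⟨hS1, hS2⟩ := memS_append.1 hS
    obtain ⟨hμ, hS3⟩ := memS_cons.1 hS2
    have hμ' : ξ ≤ μ + 1 := hμ.trans le_self_add
    have he : GLP.demote ξ (h ++ μ :: r) = GLP.demote ξ h ++ (μ - ξ) :: GLP.demote ξ r := by
      simp [GLP.demote]
    rw [he]
    refine .join _ _ _ ?_ (memS_demote hμ hr) (ih1 hS1) (ih2 hS3) ?_
    · rw [← add_one_sub hμ]
      exact memS_demote hμ' hh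
    · rw [← add_one_sub hμ, head_demote hμ' hS3]
      exact hle.demote hμ' hh (head_memS _ _)

theorem WLe.entails_or (h : WLe ξ A B) : B.toFormula ⊩ A.toFormula ∨ WLt ξ A B :=
  h.symm.imp_left fun h => (wequiv_iff.1 h).2

/-- Used to show that a normal form `h ++ μ :: r` is not equivalent to its own head `h`. -/
theorem not_wlt_of_wle_head (h : WLe (μ + 1) A (head (μ + 1) B)) : ¬ WLt μ B A := by
  intro h'
  rcases h.entails_or with h1 | h1
  · exact not_wlt_self μ A (Entails.trans h' (((entails_head _ _).trans h1).dia μ))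
  · exact not_wlt_self μ A (WLt.trans
      (WLt.anti le_self_add (show WLt (μ + 1) A B from Entails.trans (entails_head _ _) h1)) h')

/-- If `h μ r` implies `h μ s` and `h` is at most the head of `s`, then `r` is not `<_μ` below `s`. -/
theorem not_wlt_remainder {h r s : Worm.{u}} (hh : MemS (μ + 1) h)
    (hle : WLe (μ + 1) h (head (μ + 1) s))
    (heq : Worm.toFormula (h ++ μ :: r) ⊩ Worm.toFormula (h ++ μ :: s)) : ¬ WLt μ r s := by
  intro hrs
  have h2 : WLt μ s (h ++ μ :: r) :=
    Entails.trans heq (append_entails_right (hh.mono le_self_add) s)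
  rcases hle.entails_or with h1 | h1
  · exact not_wlt_self μ s
      (Entails.trans (entails_append hh ((entails_head _ _).trans h1) hrs) h2)
  · have h3 : WLt (μ + 1) (h ++ μ :: r) s := entails_dia_append (Order.lt_add_one_iff.2 le_rfl) hh
      (Entails.trans (entails_head _ _) h1) hrs
    exact not_wlt_self μ s (h2.trans (h3.anti le_self_add))

theorem head_equiv (h1 : A.toFormula ⊩ B.toFormula) (h2 : B.toFormula ⊩ A.toFormula) :
    (GLP.head ξ A).toFormula ⊩ (GLP.head ξ B).toFormula ∧
      (GLP.head ξ B).toFormula ⊩ (GLP.head ξ A).toFormula := by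
  rcases wlt_trichotomy (head_memS ξ A) (head_memS ξ B) with h | h | h
  · exact absurd (h1.trans (Entails.trans (entails_head ξ B) h)) (not_wlt_head ξ A)
  · exact h
  · exact absurd (h2.trans (Entails.trans (entails_head ξ A) h)) (not_wlt_head ξ B)

theorem NF.eq_nil_of_entails (h : Worm.toFormula [] ⊩ A.toFormula) : A = [] := by
  cases A with
  | nil => rfl
  | cons α A =>
    exact absurd (Entails.trans h ((entails_top _).dia α)) (not_wlt_self α [])

/-- Provably equivalent normal forms are equal. -/
theorem NF.eq_of_entails (hA : NF A) (hB : NF B) (h1 : A.toFormula ⊩ B.toFormula)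
    (h2 : B.toFormula ⊩ A.toFormula) : A = B := by
  induction hn : A.length + B.length using Nat.strong_induction_on generalizing A B with
  | _ n ih =>
  -- The case where the splitting modality of one worm bounds the other from below; otherwise the
  -- roles are exchanged. Equivalent worms have equivalent heads, so induction first identifies the
  -- heads.
  have key : ∀ {h μ r Y}, MemS (μ + 1) h → MemS μ r → NF h → NF r →
      WLe (μ + 1) h (GLP.head (μ + 1) r) → NF Y → MemS μ Y →
      Worm.toFormula (h ++ μ :: r) ⊩ Y.toFormula → Y.toFormula ⊩ Worm.toFormula (h ++ μ :: r) →
      (h ++ μ :: r).length + Y.length = n → h ++ μ :: r = Y := by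
    intro h μ r Y hh hr nh nr hle hY hYS e1 e2 hlen
    have hlt : μ < μ + 1 := Order.lt_add_one_iff.2 le_rfl
    have he := head_equiv (ξ := μ + 1) e1 e2
    rw [head_append_of_lt hlt, head_eq_self hh] at he
    have hYl := (head_prefix (μ + 1) Y).length_le
    simp only [List.length_append, List.length_cons] at hlen
    have hhY : h = GLP.head (μ + 1) Y := ih _ (by omega) nh (hY.head _) he.1 he.2 rfl
    cases hY with
    | nil => exact NF.eq_nil_of_entails e2
    | join h' μ' r' hh' hr' nh' nr' hle' =>
      obtain ⟨-, hS2⟩ := memS_append.1 hYS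
      rcases (memS_cons.1 hS2).1.eq_or_lt with rfl | hμ
      · rw [head_append_of_lt hlt, head_eq_self hh'] at hhY
        subst hhY
        simp only [List.length_append, List.length_cons] at hlen
        rcases wlt_trichotomy hr hr' with h3 | h3 | h3
        · exact absurd h3 (not_wlt_remainder hh hle' e1)
        · rw [ih _ (by omega) nr nr' h3.1 h3.2 rfl]
        · exact absurd h3 (not_wlt_remainder hh hle e2)
      -- Here `Y` lies in `S_(μ+1)`, so it is its own head and equals `h`, which then implies
      -- `⟨μ⟩r`.
      · have hS : MemS (μ + 1) (h' ++ μ' :: r') := by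
          have hμ1 := Order.add_one_le_iff.2 hμ
          exact memS_append.2 ⟨(hh'.mono le_self_add).mono hμ1,
            memS_cons.2 ⟨hμ1, hr'.mono hμ1⟩⟩
        rw [head_eq_self hS] at hhY
        rw [← hhY] at e2
        exact absurd (Entails.trans e2 (append_entails_right (hh.mono le_self_add) r))
          (not_wlt_of_wle_head hle)
  cases hA with
  | nil => exact (NF.eq_nil_of_entails h1).symm
  | join h μ r hh hr nh nr hle =>
    have hAS : MemS μ (h ++ μ :: r) :=
      memS_append.2 ⟨hh.mono le_self_add, memS_cons.2 ⟨le_rfl, hr⟩⟩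
    by_cases hBS : MemS μ B
    · exact key hh hr nh nr hle hB hBS h1 h2 hn
    · cases hB with
      | nil => exact NF.eq_nil_of_entails h2
      | join h' μ' r' hh' hr' nh' nr' hle' =>
        have hμ : μ' ≤ μ := by
          by_contra! hlt
          exact hBS (memS_append.2 ⟨(hh'.mono le_self_add).mono hlt.le,
            memS_cons.2 ⟨hlt.le, hr'.mono hlt.le⟩⟩)
        exact (key hh' hr' nh' nr' hle' (.join h μ r hh hr nh nr hle) (hAS.mono hμ) h2 h1
          (by omega)).symm

end Shift

/-! ## Cantor normal form projections and subtraction -/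

theorem cnfSum_append (L M : List Ordinal.{u}) : cnfSum (L ++ M) = cnfSum L + cnfSum M := by
  simp [cnfSum]

theorem IsCNF.eq_cnfSum_take_add {η : Ordinal.{u}} {L : List Ordinal.{u}} (hL : IsCNF η L) (k : ℕ) :
    η = cnfSum (L.take k) + cnfSum (L.drop k) := by
  rw [← cnfSum_append, List.take_append_drop, ← hL.2]

/-- Beyond the projection, `ξ` exceeds it by less than the next term of the normal form of `η`, and
such an excess is absorbed by that term. -/
theorem sub_CNP {ξ η : Ordinal.{u}} (h : ξ ≤ η) : η - CNP ξ η = η - ξ := by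
  obtain ⟨⟨⟨L, hL, k, hk, hs⟩, hle⟩, hmax⟩ := isGreatest_CNP ξ η
  obtain ⟨u, hu⟩ := exists_add_of_le hle
  have hη := hL.eq_cnfSum_take_add k
  rw [← hs] at hη
  have habs : u + cnfSum (L.drop k) = cnfSum (L.drop k) := by
    rcases hk.eq_or_lt with rfl | hk
    · have hd : cnfSum (L.drop L.length) = 0 := by simp [cnfSum]
      rw [hd, add_zero] at hη ⊢
      rw [hu] at h
      rw [← nonpos_iff_eq_zero]
      exact le_of_add_le_add_left (a := CNP ξ η) (by rw [add_zero]; exact h.trans hη.le)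
    · have hlt : u < Ordinal.omega0 ^ L[k] := by
        by_contra! hge
        have hmem : cnfSum (L.take (k + 1)) ∈ {x | x ∈ CNA η ∧ x ≤ ξ} := by
          refine ⟨⟨L, hL, k + 1, hk, rfl⟩, ?_⟩
          rw [List.take_succ_eq_append_getElem hk, cnfSum_append, ← hs]
          refine le_of_le_of_eq (add_le_add_right ?_ _) hu.symm
          simpa [cnfSum] using hge
        have hle' := hmax hmem
        rw [List.take_succ_eq_append_getElem hk, cnfSum_append, ← hs] at hle'
        refine absurd hle' (not_le.2 (lt_add_of_pos_right _ ?_))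
        simpa [cnfSum] using Ordinal.opow_pos L[k] Ordinal.omega0_pos
      rw [List.drop_eq_getElem_cons hk, cnfSum_cons, ← add_assoc, Ordinal.add_omega0_opow hlt]
  refine (Ordinal.sub_eq_of_add_eq hη.symm).trans (Ordinal.sub_eq_of_add_eq ?_).symm
  rw [hu, add_assoc, habs, ← hη]

theorem CNA_sub_injOn (η : Ordinal.{u}) : Set.InjOn (fun s => η - s) (CNA η) := by
  rintro _ ⟨L, hL, k, hk, rfl⟩ _ ⟨M, hM, l, hl, rfl⟩ h
  obtain rfl := hL.unique hM
  have hsub : ∀ k, η - cnfSum (L.take k) = cnfSum (L.drop k) := fun k =>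
    Ordinal.sub_eq_of_add_eq (hL.eq_cnfSum_take_add k).symm
  have hcnf : ∀ k, IsCNF (cnfSum (L.drop k)) (L.drop k) := fun k =>
    ⟨hL.1.sublist (List.drop_sublist k L), rfl⟩
  simp only [hsub] at h
  -- The differences are tails of one normal form, so uniqueness recovers where the list was cut.
  have hd := (hcnf k).unique (h ▸ hcnf l)
  have hlen := congrArg List.length hd
  rw [List.length_drop, List.length_drop] at hlen
  rw [show k = l by omega]

theorem sim_iff {ξ ζ η : Ordinal.{u}} (hξ : ξ ≤ η) (hζ : ζ ≤ η) :
    Sim η ξ ζ ↔ η - ξ = η - ζ := by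
  rw [← sub_CNP hξ, ← sub_CNP hζ]
  exact ⟨fun h => congrArg (η - ·) h,
    fun h => CNA_sub_injOn η (isGreatest_CNP ξ η).1.1 (isGreatest_CNP ζ η).1.1 h⟩

theorem head_eq_of_demote_eq {ξ ζ : Ordinal.{u}} {A : Worm.{u}}
    (h : demote ξ (head ξ A) = demote ζ (head ζ A)) : head ξ A = head ζ A := by
  have hlen : (head ξ A).length = (head ζ A).length := by
    simpa [demote] using congrArg List.length h
  exact (List.prefix_of_prefix_length_le (head_prefix ξ A) (head_prefix ζ A) hlen.le).eq_of_length
    hlen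

theorem demote_head_eq_iff {ξ ζ : Ordinal.{u}} {A : Worm.{u}} (h : head ξ A = head ζ A) :
    demote ξ (head ξ A) = demote ζ (head ζ A) ↔ ∀ η ∈ head ξ A, Sim η ξ ζ := by
  have hζ := head_memS ζ A
  rw [← h] at hζ ⊢
  rw [demote, demote, List.map_inj_left]
  exact forall₂_congr fun η hη => (sim_iff (head_memS ξ A η hη) (hζ η hη)).symm

end GLP

theorem mainTheorem6 :
    (∀ α : Ordinal.{u}, WellFounded (GLP.WLt α)) ∧
    ∀ (A : GLP.Worm.{u}), GLP.BNF A → ∀ ξ ζ : Ordinal.{u},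
      List.TFAE [
        GLP.Omega ξ A = GLP.Omega ζ A,
        GLP.o ξ (GLP.head ξ A) = GLP.o ζ (GLP.head ζ A),
        GLP.demote ξ (GLP.head ξ A) = GLP.demote ζ (GLP.head ζ A),
        GLP.head ξ A = GLP.head ζ A ∧
          GLP.demote ξ (GLP.head ξ A) = GLP.demote ζ (GLP.head ζ A),
        GLP.head ξ A = GLP.head ζ A ∧ ∀ η ∈ GLP.head ξ A, GLP.Sim η ξ ζ] := by
  refine ⟨GLP.wellFounded_wlt, fun A hA ξ ζ => ?_⟩
  tfae_have 1 ↔ 2 := by rw [GLP.Omega_eq_o_head, GLP.Omega_eq_o_head]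
  tfae_have 2 → 3 := fun h => by
    rw [GLP.o_eq_o_demote (GLP.head_memS ξ A), GLP.o_eq_o_demote (GLP.head_memS ζ A)] at h
    have he := GLP.entails_of_o_eq h
    exact GLP.NF.eq_of_entails ((hA.nf.head ξ).demote (GLP.head_memS ξ A))
      ((hA.nf.head ζ).demote (GLP.head_memS ζ A)) he.1 he.2
  tfae_have 3 → 2 := fun h => by
    rw [GLP.o_eq_o_demote (GLP.head_memS ξ A), GLP.o_eq_o_demote (GLP.head_memS ζ A), h]
  tfae_have 3 ↔ 4 := ⟨fun h => ⟨GLP.head_eq_of_demote_eq h, h⟩, And.right⟩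
  tfae_have 4 ↔ 5 := and_congr_right GLP.demote_head_eq_iff
  tfae_finish
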